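/- Logarithms are to base $2$. An $r$-graph is a finite hypergraph all of whose edges have exactly $r$ vertices (no repeated edges); it is linear if any two distinct edges share at most one vertex. Its average degree $d(G)$ is the mean, over all vertices, of the number of edges containing the vertex. A linear cycle of length $\ell\ge 3$ in an $r$-graph consists of $\ell$ distinct edges $e_1,\dots,e_\ell$, covering exactly $(r-1)\ell$ vertices, such that $|e_i\cap e_j|=1$ if $j\equiv i\pm1 \pmod \ell$ and $e_i\cap e_j=\emptyset$ for all other $i\neq j$. Theorem. Let $r\ge 3$ and $k\ge 2$ be integers, and let $c_1=128\,r^{2r+3}$ and $c_2=\log(64\,r^{2r+2})$. If $G$ is an $n$-vertex linear $r$-graph with average degree $d(G)\ge c_1k$, then $G$ contains linear cycles of $k$ consecutive even lengths, the shortest of which has length at most $$2\left\lceil\frac{\log n}{\log(d(G)/k)-c_2}\right\rceil ;$$ that is, there is an integer $m\le\left\lceil\frac{\log n}{\log(d(G)/k)-c_2}\right\rceil$ such that $G$ contains linear cycles of lengths $2m,2m+2,\dots,2m+2(k-1)$. -/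

import Mathlib

open scoped Hypergraph

namespace LinearCycles

variable {α : Type*}

/-- `G` is an `r`-graph: every edge has exactly `r` vertices. -/
def IsUniform (G : Hypergraph α) (r : ℕ) : Prop :=
  ∀ e ∈ E(G), e.encard = r

/-- `G` is linear: any two distinct edges share at most one vertex. -/
def IsLinear (G : Hypergraph α) : Prop :=
  ∀ e ∈ E(G), ∀ f ∈ E(G), e ≠ f → (e ∩ f).encard ≤ 1

/-- The degree of a vertex `v`: the number of edges containing `v`. -/
noncomputable def degree (G : Hypergraph α) (v : α) : ℕ :=
  {e ∈ E(G) | v ∈ e}.ncard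

/-- The average degree of a (finite) hypergraph: the mean of the degrees over all vertices. -/
noncomputable def avgDegree (G : Hypergraph α) : ℝ :=
  (∑ᶠ v ∈ V(G), (degree G v : ℝ)) / (V(G).ncard : ℝ)

/-- Cyclic adjacency of indices modulo `l`: `j = i + 1` or `i = j + 1` modulo `l`. -/
def CyclicAdj {l : ℕ} (i j : Fin l) : Prop :=
  (j : ℕ) = (i + 1) % l ∨ (i : ℕ) = (j + 1) % l

/-- `e` lists, in cyclic order, the edges of an `r`-uniform linear cycle of length `l`: these are
`l ≥ 3` distinct `r`-sets on `(r - 1) * l` vertices in all, cyclically consecutive ones share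
exactly one vertex, and all other pairs are disjoint. -/
structure IsLinearCycle (r : ℕ) {l : ℕ} (e : Fin l → Set α) : Prop where
  three_le : 3 ≤ l
  injective : Function.Injective e
  card_edge : ∀ i, (e i).encard = r
  card_vertices : (⋃ i, e i).encard = ((r - 1) * l : ℕ)
  inter_adj : ∀ i j, CyclicAdj i j → (e i ∩ e j).encard = 1
  inter_not_adj : ∀ i j, i ≠ j → ¬ CyclicAdj i j → e i ∩ e j = ∅

/-- `G` contains an `r`-uniform linear cycle of length `l` as a subgraph. -/
def ContainsLinearCycle (G : Hypergraph α) (r l : ℕ) : Prop :=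
  ∃ e : Fin l → Set α, (∀ i, e i ∈ E(G)) ∧ IsLinearCycle r e

end LinearCycles

/-! Breadth-first search, with vertices weighted by degree because no maximum degree bound is
available. Passing to a vertex set minimal for edge density `d / r` makes every degree at least `d /
r`. A tree is grown from a vertex of maximum degree `Δ`. Its leaves carry weight (total degree) `W`,
much more than all the inner vertices, so at least half of the edge incidences at leaves belong to
edges avoiding the inner vertices. Sampling a random set `R` of leaves
(`IsBranching.exists_sampling`) leaves a family `F` of at least `W / 2 ^ (r + 1)` edges, each
meeting the branches to `R` in a single vertex `v f ∈ R`.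

A maximal matching among the sets `f \ {v f}`, with union `U`, gives every `f ∈ F` a second vertex
`u f ∈ U`. The pairs `{v f, u f}` form an auxiliary graph between `R` and `U`. If it is dense, a
connected piece of large minimum degree, joined to the tree below a last common ancestor, gives
cycles of `k` consecutive even lengths (`IsBranching.exists_closed_linearPath`). If it is sparse,
`U` is large and the matching extends the tree, multiplying the weight by at least `γ`
(`HasHeavyTree.succ`).

At height `t` the weight is at least `γ ^ t * Δ` and at most `n * Δ`, so `γ ^ t ≤ n`: growth stops,
and the dense case occurs, at a height less than the bound claimed. -/

namespace LinearCycles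

open Finset Classical

variable {α : Type*}

/-! ### Linear paths and linear cycles -/

/-- A linear path with `n` edges from `a` to `b` in `E`. Each edge is split into a block and the
vertex leading to the next block; `S` is the union of the blocks, so it contains all vertices of
the path but `b`. -/
inductive LinearPath (E : Finset (Finset α)) : ℕ → α → α → Finset α → Prop
  | nil (a : α) : LinearPath E 0 a a ∅
  | cons {n : ℕ} {a c b : α} {D S : Finset α} (ha : a ∈ D) (hc : c ∉ D) (hE : insert c D ∈ E)
      (hD : Disjoint D S) (h : LinearPath E n c b S) : LinearPath E (n + 1) a b (D ∪ S)

namespace LinearPath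

variable {E : Finset (Finset α)} {n m : ℕ} {a b c : α} {S T : Finset α}

theorem append (h : LinearPath E n a b S) (h' : LinearPath E m b c T) (hST : Disjoint S T) :
    LinearPath E (n + m) a c (S ∪ T) := by
  induction h with
  | nil a => simpa using h'
  | cons ha hc hE hD h ih =>
    rw [disjoint_union_left] at hST
    have := LinearPath.cons ha hc hE (disjoint_union_right.2 ⟨hD, hST.1⟩) (ih h' hST.2)
    rw [← union_assoc] at this
    convert this using 1
    omega

theorem single {D : Finset α} (ha : a ∈ D) (hc : c ∉ D) (hE : insert c D ∈ E) :
    LinearPath E 1 a c D := by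
  simpa using LinearPath.cons ha hc hE (disjoint_empty_right D) (LinearPath.nil c)

theorem start_mem (h : LinearPath E n a b S) : a = b ∧ S = ∅ ∨ a ∈ S := by
  cases h with
  | nil => simp
  | cons ha => exact Or.inr (mem_union_left _ ha)

/-- Reversed, each edge drops its old starting vertex from its block and takes in its old end, so
overall the union trades `a` for `b`. -/
theorem reverse (h : LinearPath E n a b S) (hb : b ∉ S) :
    LinearPath E n b a ((insert b S).erase a) := by
  induction h with
  | nil a => simpa using LinearPath.nil a
  | @cons n a c b D S ha hc hE hD h ih =>
    simp only [mem_union, not_or] at hb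
    have h1 := ih hb.2
    have hac : a ≠ c := fun h => hc (h ▸ ha)
    have haS : a ∉ S := fun h => (disjoint_left.1 hD ha) h
    have h2 : LinearPath E 1 c a (insert c (D.erase a)) := by
      refine single (mem_insert_self _ _) ?_ ?_
      · simp [hac]
      · rwa [insert_comm, insert_erase ha]
    have hc' : c = b ∨ c ∈ S := h.start_mem.imp And.left id
    have h3 := h1.append h2 (by
      rw [disjoint_left] at hD ⊢
      intro y hy hy'
      simp only [mem_erase, mem_insert] at hy hy'
      grind)
    convert h3 using 1
    ext y
    simp only [mem_union, mem_erase, mem_insert]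
    rw [disjoint_left] at hD
    grind

theorem exists_blocks (h : LinearPath E n a b S) :
    ∃ (D : ℕ → Finset α) (p : ℕ → α), p 0 = a ∧ p n = b ∧
      (∀ i < n, p i ∈ D i ∧ p (i + 1) ∉ D i ∧ insert (p (i + 1)) (D i) ∈ E ∧ D i ⊆ S) ∧
      ∀ i < n, ∀ j < n, i ≠ j → Disjoint (D i) (D j) := by
  induction h with
  | nil a => exact ⟨fun _ => ∅, fun _ => a, rfl, rfl, by simp, by simp⟩
  | @cons n a c b D S ha hc hE hD h ih =>
    obtain ⟨D', p, hp0, hpn, h1, h2⟩ := ih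
    refine ⟨fun i => Nat.casesOn i D D', fun i => Nat.casesOn i a p, rfl, hpn, ?_, ?_⟩
    · rintro (_ | i) hi
      · simp only [hp0]
        exact ⟨ha, hc, hE, subset_union_left⟩
      · obtain ⟨q1, q2, q3, q4⟩ := h1 i (by omega)
        exact ⟨q1, q2, q3, q4.trans subset_union_right⟩
    · rintro (_ | i) hi (_ | j) hj hij
      · exact absurd rfl hij
      · exact hD.mono_right (h1 j (by omega)).2.2.2
      · exact (hD.mono_right (h1 i (by omega)).2.2.2).symm
      · exact h2 i (by omega) j (by omega) (by omega)

end LinearPath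

/-- Disjointness of the blocks forces every common vertex of two edges to be a junction `c i`. As `l
≥ 3`, no two edges follow each other in both directions, so neighbours share only one junction. -/
theorem isLinearCycle_of_blocks {r l : ℕ} (hl : 3 ≤ l) (D : Fin l → Finset α) (c : Fin l → α)
    (hD : ∀ i j, i ≠ j → Disjoint (D i) (D j)) (hcard : ∀ i, #(D i) + 1 = r)
    (hc : ∀ i j : Fin l, (j : ℕ) = (i + 1) % l → c i ∈ D j) :
    IsLinearCycle r (fun i => ((insert (c i) (D i) : Finset α) : Set α)) := by
  have hlt : ∀ i : Fin l, ((i : ℕ) + 1) % l < l := fun i => Nat.mod_lt _ (by omega)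
  let s : Fin l → Fin l := fun i => ⟨((i : ℕ) + 1) % l, hlt i⟩
  have hs : ∀ i, c i ∈ D (s i) := fun i => hc i _ rfl
  have hsinj : ∀ i j, s i = s j → i = j := by
    intro i j h
    have h' : ((i : ℕ) + 1) % l = (j + 1) % l := congrArg Fin.val h
    have : ((i : ℕ) : ℕ) ≡ j [MOD l] := Nat.ModEq.add_right_cancel' 1 h'
    exact Fin.ext (Nat.ModEq.eq_of_lt_of_lt this i.2 j.2)
  have hmem : ∀ y i j, y ∈ D i → y ∈ D j → i = j := by
    intro y i j h1 h2
    by_contra h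
    exact disjoint_left.1 (hD i j h) h1 h2
  have hsne : ∀ i, s i ≠ i := by
    intro i h
    have h' : ((i : ℕ) + 1) % l = i := congrArg Fin.val h
    have := i.2
    rcases Nat.lt_or_ge ((i : ℕ) + 1) l with h2 | h2
    · rw [Nat.mod_eq_of_lt h2] at h'; omega
    · have h3 : (i : ℕ) + 1 = l := by omega
      rw [h3, Nat.mod_self] at h'; omega
  have hss : ∀ i, s (s i) ≠ i := by
    intro i h
    have h' : (((i : ℕ) + 1) % l + 1) % l = i := congrArg Fin.val h
    have := i.2
    rcases Nat.lt_or_ge ((i : ℕ) + 2) l with h2 | h2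
    · rw [Nat.mod_eq_of_lt (by omega : (i : ℕ) + 1 < l), Nat.mod_eq_of_lt (by omega)] at h'; omega
    · rcases Nat.lt_or_ge ((i : ℕ) + 1) l with h3 | h3
      · rw [Nat.mod_eq_of_lt h3, show (i : ℕ) + 1 + 1 = l by omega, Nat.mod_self] at h'; omega
      · rw [show (i : ℕ) + 1 = l by omega, Nat.mod_self, Nat.mod_eq_of_lt (by omega)] at h'; omega
  have hcD : ∀ i, c i ∉ D i := fun i h => hsne i (hmem _ _ _ (hs i) h)
  have hinter : ∀ i j y, i ≠ j → y ∈ insert (c i) (D i) → y ∈ insert (c j) (D j) →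
      (y = c i ∧ j = s i) ∨ (y = c j ∧ i = s j) := by
    intro i j y hij h1 h2
    rw [mem_insert] at h1 h2
    rcases h1 with h1 | h1 <;> rcases h2 with h2 | h2
    · exact absurd (hsinj i j (hmem y _ _ (h1 ▸ hs i) (h2 ▸ hs j))) hij
    · exact Or.inl ⟨h1, hmem y _ _ h2 (h1 ▸ hs i)⟩
    · exact Or.inr ⟨h2, hmem y _ _ h1 (h2 ▸ hs j)⟩
    · exact absurd (hmem y _ _ h1 h2) hij
  have hadj : ∀ i, ((insert (c i) (D i) : Finset α) : Set α) ∩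
      ((insert (c (s i)) (D (s i)) : Finset α) : Set α) = {c i} := by
    intro i
    ext y
    simp only [Set.mem_inter_iff, mem_coe, Set.mem_singleton_iff]
    constructor
    · rintro ⟨h1, h2⟩
      rcases hinter i (s i) y (hsne i).symm h1 h2 with h | h
      · exact h.1
      · exact absurd h.2.symm (hss i)
    · rintro rfl
      exact ⟨mem_insert_self _ _, mem_insert_of_mem (hs i)⟩
  have hne : ∀ i, (D i).Nonempty := by
    intro i
    have hbij : Function.Bijective s := (Finite.injective_iff_bijective).1 (fun i j => hsinj i j)
    obtain ⟨j, rfl⟩ := hbij.2 i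
    exact ⟨_, hs j⟩
  have hunion : (⋃ i, ((insert (c i) (D i) : Finset α) : Set α)) =
      ((univ.biUnion D : Finset α) : Set α) := by
    ext y
    simp only [Set.mem_iUnion, mem_coe, mem_insert, mem_biUnion, mem_univ, true_and]
    constructor
    · rintro ⟨i, rfl | h⟩
      · exact ⟨_, hs i⟩
      · exact ⟨i, h⟩
    · rintro ⟨i, h⟩
      exact ⟨i, Or.inr h⟩
  refine ⟨hl, ?_, ?_, ?_, ?_, ?_⟩
  · intro i j hij
    by_contra hne'
    have hij' : insert (c i) (D i) = insert (c j) (D j) := coe_injective hij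
    rcases (hne i) with ⟨y, hy⟩
    have e1 : ∀ y ∈ D i, y = c j ∧ i = s j := by
      intro y hy
      rcases hinter i j y hne' (mem_insert_of_mem hy) (hij' ▸ mem_insert_of_mem hy) with h | h
      · exact absurd hy (h.1 ▸ hcD i)
      · exact h
    have e2 : ∀ y ∈ D j, y = c i ∧ j = s i := by
      intro y hy
      rcases hinter i j y hne' (hij' ▸ mem_insert_of_mem hy) (mem_insert_of_mem hy) with h | h
      · exact h
      · exact absurd hy (h.1 ▸ hcD j)
    obtain ⟨y', hy'⟩ := hne j
    have h1 := (e1 y hy).2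
    have h2 := (e2 y' hy').2
    exact hss j (by rw [← h1, ← h2])
  · intro i
    rw [Set.encard_coe_eq_coe_finsetCard, card_insert_of_notMem (hcD i), hcard i]
  · rw [hunion, Set.encard_coe_eq_coe_finsetCard, card_biUnion (fun i _ j _ h => hD i j h)]
    have : ∀ i, #(D i) = r - 1 := fun i => by have := hcard i; omega
    simp [this, mul_comm]
  · rintro i j (h | h)
    · have : j = s i := Fin.ext h
      subst this
      rw [hadj, Set.encard_singleton]
    · have : i = s j := Fin.ext h
      subst this
      rw [Set.inter_comm, hadj, Set.encard_singleton]
  · intro i j hij hnadj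
    ext y
    simp only [Set.mem_inter_iff, mem_coe, Set.mem_empty_iff_false, iff_false, not_and]
    intro h1 h2
    rcases hinter i j y hij h1 h2 with h | h
    · exact hnadj (Or.inl (congrArg Fin.val h.2))
    · exact hnadj (Or.inr (congrArg Fin.val h.2))

/-- The vertex set of a path omits its end, so a path may return to its start; the last junction
then lies in the first block. -/
theorem LinearPath.containsLinearCycle {E : Finset (Finset α)} {r n : ℕ} {a : α} {S : Finset α}
    {G : Hypergraph α} (hE : ∀ f ∈ E, (f : Set α) ∈ E(G)) (hr : ∀ f ∈ E, #f = r) (hn : 3 ≤ n)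
    (h : LinearPath E n a a S) : ContainsLinearCycle G r n := by
  obtain ⟨D, p, hp0, hpn, h1, h2⟩ := h.exists_blocks
  refine ⟨fun i => ((insert (p (i + 1)) (D i) : Finset α) : Set α),
    fun i => hE _ (h1 i i.2).2.2.1, ?_⟩
  refine isLinearCycle_of_blocks hn (fun i => D i) (fun i => p (i + 1)) ?_ ?_ ?_
  · intro i j hij
    exact h2 i i.2 j j.2 (fun h => hij (Fin.ext h))
  · intro i
    rw [← hr _ (h1 i i.2).2.2.1, card_insert_of_notMem (h1 i i.2).2.1]
  · intro i j hij
    rcases Nat.lt_or_ge ((i : ℕ) + 1) n with h3 | h3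
    · rw [Nat.mod_eq_of_lt h3] at hij
      rw [← hij]
      exact (h1 j j.2).1
    · have h4 : (i : ℕ) + 1 = n := by have := i.2; omega
      rw [h4, Nat.mod_self] at hij
      rw [h4, hpn, hij, ← hp0]
      exact (h1 0 (by omega)).1

/-! ### Minimal dense vertex sets -/

/-- A set of vertices minimal with respect to spanning `s` edges per vertex. -/
structure IsMinimalDense {ι : Type*} (E : Finset ι) (σ : ι → Finset α) (s : ℝ) (X : Finset α) :
    Prop where
  nonempty : X.Nonempty
  dense : s * #X ≤ #{f ∈ E | σ f ⊆ X}
  sparse : ∀ Y ⊂ X, Y.Nonempty → (#{f ∈ E | σ f ⊆ Y} : ℝ) < s * #Y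

theorem exists_isMinimalDense {ι : Type*} (E : Finset ι) (σ : ι → Finset α) (s : ℝ)
    (Y : Finset α) (hY : Y.Nonempty) (h : s * #Y ≤ #{f ∈ E | σ f ⊆ Y}) :
    ∃ X ⊆ Y, IsMinimalDense E σ s X := by
  induction Y using Finset.strongInduction with
  | H Y ih =>
    by_cases hex : ∃ Z ⊂ Y, Z.Nonempty ∧ s * #Z ≤ #{f ∈ E | σ f ⊆ Z}
    · obtain ⟨Z, hZ, hne, hd⟩ := hex
      obtain ⟨X, hX, hm⟩ := ih Z hZ hne hd
      exact ⟨X, hX.trans hZ.1, hm⟩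
    · push Not at hex
      exact ⟨Y, Subset.rfl, hY, h, hex⟩

namespace IsMinimalDense

variable {ι : Type*} {E : Finset ι} {σ : ι → Finset α} {s : ℝ} {X : Finset α}

/-- Deleting a vertex of degree at most `s` would preserve the density. A one-vertex set is treated
apart: it spans no edge. -/
theorem lt_degree (h : IsMinimalDense E σ s X) (hs : 0 < s) (hσ : ∀ f ∈ E, 2 ≤ #(σ f)) {x : α}
    (hx : x ∈ X) : s < #{f ∈ E | σ f ⊆ X ∧ x ∈ σ f} := by
  have hsplit : #{f ∈ E | σ f ⊆ X} = #{f ∈ E | σ f ⊆ X.erase x} +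
      #{f ∈ E | σ f ⊆ X ∧ x ∈ σ f} := by
    rw [← card_union_of_disjoint]
    · congr 1
      ext f
      simp only [mem_filter, mem_union, subset_erase]
      tauto
    · rw [disjoint_left]
      intro f
      simp only [mem_filter, subset_erase]
      tauto
  have hd := h.dense
  have hcard : (#X : ℝ) = #(X.erase x) + 1 := by exact_mod_cast (card_erase_add_one hx).symm
  rw [hsplit] at hd
  push_cast at hd
  rcases (X.erase x).eq_empty_or_nonempty with he | hne
  · exfalso
    have hd := h.dense
    have : #{f ∈ E | σ f ⊆ X} = 0 := by
      rw [card_eq_zero, filter_eq_empty_iff]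
      intro f hf hfX
      have h1 := card_le_card hfX
      have h2 := hσ f hf
      have h3 := card_erase_add_one hx
      rw [he, card_empty] at h3
      omega
    rw [this, hcard, he] at hd
    simp at hd
    linarith
  · have := h.sparse _ (erase_ssubset hx) hne
    rw [hcard] at hd
    nlinarith

/-- Connectedness: without a crossing edge the two sparse parts would together span too few edges.
-/
theorem exists_crossing (h : IsMinimalDense E σ s X) {Y : Finset α} (hYX : Y ⊆ X)
    (hY : Y.Nonempty) (hXY : (X \ Y).Nonempty) :
    ∃ f ∈ E, σ f ⊆ X ∧ ¬ σ f ⊆ Y ∧ ¬ σ f ⊆ X \ Y := by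
  by_contra hno
  push Not at hno
  have h1 := h.sparse Y ⟨hYX, fun h' => by
    obtain ⟨z, hz⟩ := hXY
    rw [mem_sdiff] at hz
    exact hz.2 (h' hz.1)⟩ hY
  have h2 := h.sparse (X \ Y) (sdiff_ssubset hYX hY) hXY
  have h3 : #{f ∈ E | σ f ⊆ X} ≤ #{f ∈ E | σ f ⊆ Y} + #{f ∈ E | σ f ⊆ X \ Y} := by
    refine (card_le_card ?_).trans (card_union_le _ _)
    intro f
    simp only [mem_filter, mem_union]
    rintro ⟨hf, hfX⟩
    by_cases hfY : σ f ⊆ Y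
    · exact Or.inl ⟨hf, hfY⟩
    · exact Or.inr ⟨hf, hno f hf hfX hfY⟩
  have h4 : (#X : ℝ) = #Y + #(X \ Y) := by
    rw [← Nat.cast_add, card_sdiff_of_subset hYX, Nat.add_sub_cancel' (card_le_card hYX)]
  have h5 := h.dense
  have h6 : (#{f ∈ E | σ f ⊆ X} : ℝ) ≤ #{f ∈ E | σ f ⊆ Y} + #{f ∈ E | σ f ⊆ X \ Y} := by
    exact_mod_cast h3
  rw [h4] at h5
  linarith

end IsMinimalDense

/-! ### Paths along branches and greedy paths -/

namespace LinearPath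

variable {E E' : Finset (Finset α)} {n : ℕ} {a b : α} {S : Finset α}

theorem mono (hE : E ⊆ E') (h : LinearPath E n a b S) : LinearPath E' n a b S := by
  induction h with
  | nil a => exact .nil a
  | cons ha hc hE' hD _ ih => exact .cons ha hc (hE hE') hD ih

theorem exists_edge_of_mem (h : LinearPath E n a b S) {y : α} (hy : y ∈ S) : ∃ f ∈ E, y ∈ f := by
  induction h with
  | nil a => simp at hy
  | cons ha hc hE hD _ ih =>
    rcases mem_union.1 hy with hy | hy
    · exact ⟨_, hE, mem_insert_of_mem hy⟩
    · exact ih hy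

end LinearPath

/-- A descending branch of a tree is a linear path. -/
theorem exists_linearPath_descending {E : Finset (Finset α)} {t : ℕ} {p : ℕ → α}
    {e : ℕ → Finset α} (hE : ∀ i < t, e i ∈ E) (hl : ∀ i < t, p i ∈ e i)
    (hr : ∀ i < t, p (i + 1) ∈ (e i).erase (p i))
    (hd : ∀ i < t, ∀ j < t, ∀ y ∈ (e i).erase (p i), y ∈ (e j).erase (p j) → i = j)
    {d : ℕ} (hdt : d ≤ t) :
    ∃ S, LinearPath E d (p t) (p (t - d)) S ∧
      ∀ y ∈ S, ∃ i, t - d ≤ i ∧ i < t ∧ y ∈ (e i).erase (p i) := by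
  induction d with
  | zero => exact ⟨∅, .nil _, by simp⟩
  | succ d ih =>
    obtain ⟨S, hS, hS'⟩ := ih (by omega)
    have hj : t - d = t - (d + 1) + 1 := by omega
    have hjt : t - (d + 1) < t := by omega
    refine ⟨_, hS.append (LinearPath.single (D := (e (t - (d + 1))).erase (p (t - (d + 1))))
      (hj ▸ hr _ hjt) (notMem_erase _ _) ?_) ?_, ?_⟩
    · rw [insert_erase (hl _ hjt)]
      exact hE _ hjt
    · rw [disjoint_left]
      intro y hy hy'
      obtain ⟨i, hi, hit, hyi⟩ := hS' y hy
      have := hd i hit _ hjt y hyi hy'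
      omega
    · intro y hy
      rcases mem_union.1 hy with hy | hy
      · obtain ⟨i, hi, hit, hyi⟩ := hS' y hy
        exact ⟨i, by omega, hit, hyi⟩
      · exact ⟨_, le_rfl, hjt, hy⟩

/-- Greedy construction of a linear path of prescribed length which avoids a small set. -/
theorem exists_linearPath_avoiding {F : Finset (Finset α)} {r : ℕ} {v u : Finset α → α}
    {R X Q : Finset α} (hr : ∀ f ∈ F, #f = r)
    (hlin : ∀ f ∈ F, ∀ g ∈ F, f ≠ g → #(f ∩ g) ≤ 1)
    (hv : ∀ f ∈ F, v f ∈ f ∧ v f ∈ R ∧ v f ∈ X) (hu : ∀ f ∈ F, u f ∈ f ∧ u f ∉ R ∧ u f ∈ X)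
    {m : ℕ} (hdeg : ∀ y ∈ X, #Q + r * m < #{f ∈ F | y = v f ∨ y = u f})
    {x : α} (hx : x ∈ X) (hxR : x ∉ R) {n : ℕ} (hn : n ≤ m + 1) :
    ∃ y ∈ X, ∃ S, LinearPath F n y x S ∧ Disjoint S Q ∧ #S ≤ r * n ∧ (y ∈ R ↔ Odd n) := by
  induction n with
  | zero => exact ⟨x, hx, ∅, .nil x, by simp, by simp, by simpa using hxR⟩
  | succ n ih =>
    obtain ⟨y, hy, S, hS, hSQ, hcard, hyR⟩ := ih (by omega)
    -- By linearity, each vertex of `S ∪ Q` spoils at most one of the edges at `y`, and there are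
    -- more edges than such vertices.
    obtain ⟨g, hg, hyg, hdis⟩ :
        ∃ g ∈ F, (y = v g ∨ y = u g) ∧ Disjoint (g.erase y) (S ∪ Q) := by
      by_contra hno
      push Not at hno
      have hch : ∀ g ∈ F.filter (fun f => y = v f ∨ y = u f), ∃ z ∈ S ∪ Q, z ∈ g.erase y := by
        intro g hg
        obtain ⟨hg, hyg⟩ := mem_filter.1 hg
        have := hno g hg hyg
        rw [not_disjoint_iff] at this
        obtain ⟨z, hz, hz'⟩ := this
        exact ⟨z, hz', hz⟩
      have : Nonempty α := ⟨x⟩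
      choose! z hz hzg using hch
      have hle : #{f ∈ F | y = v f ∨ y = u f} ≤ #(S ∪ Q) := by
        refine card_le_card_of_injOn z (fun g hg => hz g hg) ?_
        intro g hg g' hg' hgg
        by_contra hne
        have hg0 := mem_filter.1 hg
        have hg0' := mem_filter.1 hg'
        have hyin : ∀ f ∈ F, (y = v f ∨ y = u f) → y ∈ f := by
          rintro f hf (h | h)
          · exact h ▸ (hv f hf).1
          · exact h ▸ (hu f hf).1
        have h1 := hlin g hg0.1 g' hg0'.1 hne
        have h2 := mem_erase.1 (hzg g hg)
        have h3 := mem_erase.1 (hzg g' hg')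
        refine h2.1 (card_le_one.1 h1 _ ?_ _ ?_)
        · exact mem_inter.2 ⟨h2.2, hgg ▸ h3.2⟩
        · exact mem_inter.2 ⟨hyin g hg0.1 hg0.2, hyin g' hg0'.1 hg0'.2⟩
      have h1 := hdeg y hy
      have h2 := card_union_le S Q
      have h3 : r * n ≤ r * m := Nat.mul_le_mul_left r (by omega)
      omega
    rw [disjoint_union_right] at hdis
    have hyg' : y ∈ g := by
      rcases hyg with h | h
      · exact h ▸ (hv g hg).1
      · exact h ▸ (hu g hg).1
    have hvu : v g ≠ u g := fun h => (hu g hg).2.1 (h ▸ (hv g hg).2.1)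
    obtain ⟨y', hy', hy'g, hy'R⟩ : ∃ y' ∈ X, y' ∈ g.erase y ∧ (y' ∈ R ↔ y ∉ R) := by
      rcases hyg with h | h
      · refine ⟨u g, (hu g hg).2.2, mem_erase.2 ⟨h ▸ hvu.symm, (hu g hg).1⟩, ?_⟩
        simp [h, (hu g hg).2.1, (hv g hg).2.1]
      · refine ⟨v g, (hv g hg).2.2, mem_erase.2 ⟨h ▸ hvu, (hv g hg).1⟩, ?_⟩
        simp [h, (hu g hg).2.1, (hv g hg).2.1]
    refine ⟨y', hy', _, .cons hy'g (notMem_erase y g) (by rwa [insert_erase hyg']) hdis.1 hS,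
      disjoint_union_left.2 ⟨hdis.2, hSQ⟩, ?_, ?_⟩
    · have h1 := card_union_le (g.erase y) S
      have h2 : #(g.erase y) ≤ r := (card_erase_le).trans (hr g hg).le
      have h3 : r * (n + 1) = r * n + r := by ring
      omega
    · rw [hy'R, hyR, Nat.odd_add_one]

/-! ### Closing cycles through a tree -/

/-- A tree of height `t` with root `x` and set of leaves `L`. The leaf `a` is reached through the
vertices `P a 0 = x, …, P a t = a` and the edges `e a 0, …, e a (t - 1)`; `blk a` is the last edge
on the way to `a` without its lower vertex, and `O` contains the vertices at lower levels. -/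
structure IsBranching (E : Finset (Finset α)) (x : α) (t : ℕ) (L O : Finset α)
    (blk : α → Finset α) (P : α → ℕ → α) (e : α → ℕ → Finset α) : Prop where
  root : ∀ a ∈ L, P a 0 = x
  leaf : ∀ a ∈ L, P a t = a
  edge_mem : ∀ a ∈ L, ∀ i < t, e a i ∈ E
  left_mem : ∀ a ∈ L, ∀ i < t, P a i ∈ e a i
  right_mem : ∀ a ∈ L, ∀ i < t, P a (i + 1) ∈ (e a i).erase (P a i)
  blocks : ∀ a ∈ L, ∀ b ∈ L, ∀ i < t, ∀ j < t, ∀ y ∈ (e a i).erase (P a i),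
    y ∈ (e b j).erase (P b j) → i = j ∧ P a (i + 1) = P b (i + 1)
  parent : ∀ a ∈ L, ∀ b ∈ L, ∀ i < t, P a (i + 1) = P b (i + 1) → P a i = P b i
  root_notMem : ∀ a ∈ L, ∀ i < t, x ∉ (e a i).erase (P a i)
  mem_blk : ∀ a ∈ L, a ∈ blk a
  disjoint_blk : ∀ a ∈ L, ∀ b ∈ L, a ≠ b → Disjoint (blk a) (blk b)
  root_mem : ∀ a ∈ L, x ∈ O ∪ blk a
  edge_subset : ∀ a ∈ L, ∀ i < t, e a i ⊆ O ∪ blk a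
  card_inter_blk : ∀ a ∈ L, ∀ f ∈ E, Disjoint f O → #(f ∩ blk a) ≤ 1

/-- The cycle goes from a leaf up to a common ancestor at level `j`, down to another leaf `y`,
through `2 * i + 1` edges of `F` to some `u f`, and back by one more edge. Only the third stretch
varies with `i`. -/
theorem IsBranching.exists_closed_linearPath {E : Finset (Finset α)} {x : α} {t : ℕ}
    {L O : Finset α} {blk : α → Finset α} {P : α → ℕ → α} {e : α → ℕ → Finset α}
    (hB : IsBranching E x t L O blk P e) {r k : ℕ} (hr : 2 ≤ r) (hk : 1 ≤ k)
    (hunif : ∀ f ∈ E, #f = r) (hlin : ∀ f ∈ E, ∀ g ∈ E, f ≠ g → #(f ∩ g) ≤ 1)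
    {R : Finset α} (hR : R ⊆ L) {F : Finset (Finset α)} (hFE : F ⊆ E) {v u : Finset α → α}
    (hv : ∀ f ∈ F, v f ∈ f ∧ v f ∈ R)
    (hF : ∀ f ∈ F, ∀ a ∈ R, ∀ y ∈ f, y ∈ O ∪ blk a → a = v f ∧ y = v f)
    (hu : ∀ f ∈ F, u f ∈ f ∧ u f ≠ v f) {X : Finset α}
    (hX : IsMinimalDense F (fun f => {v f, u f}) (2 * k * r : ℕ) X) :
    ∃ j < t, ∀ i < k, ∃ a S, LinearPath E (2 * (t - j) + 2 * (i + 1)) a a S := by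
  have huR : ∀ f ∈ F, u f ∉ R := fun f hf h =>
    (hu f hf).2 (hF f hf _ h _ (hu f hf).1 (mem_union_right _ (hB.mem_blk _ (hR h)))).2
  set FX := F.filter (fun f => ({v f, u f} : Finset α) ⊆ X) with hFX
  have hFXF : ∀ f ∈ FX, f ∈ F ∧ v f ∈ X ∧ u f ∈ X := by
    intro f hf
    obtain ⟨h1, h2⟩ := mem_filter.1 hf
    exact ⟨h1, h2 (by simp), h2 (by simp)⟩
  have hFX_of : ∀ f ∈ F, ({v f, u f} : Finset α) ⊆ X → f ∈ FX := fun f hf h =>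
    mem_filter.2 ⟨hf, h⟩
  have hkr : 2 ≤ 2 * k * r := by nlinarith
  have hdeg : ∀ y ∈ X, 2 * k * r < #{f ∈ FX | y = v f ∨ y = u f} := by
    intro y hy
    have h1 := hX.lt_degree (by exact_mod_cast (by omega : 0 < 2 * k * r))
      (fun f hf => by rw [card_pair (hu f hf).2.symm]) hy
    have h2 : {f ∈ FX | y = v f ∨ y = u f} =
        {f ∈ F | ({v f, u f} : Finset α) ⊆ X ∧ y ∈ ({v f, u f} : Finset α)} := by
      rw [hFX, filter_filter]
      simp only [mem_insert, mem_singleton]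
    rw [h2]
    exact_mod_cast h1
  obtain ⟨y₀, hy₀⟩ := hX.nonempty
  obtain ⟨f₀, hf₀⟩ : FX.Nonempty := by
    have h1 := hdeg y₀ hy₀
    obtain ⟨f, hf⟩ := card_pos.1 (by omega : 0 < #{f ∈ FX | y₀ = v f ∨ y₀ = u f})
    exact ⟨f, (mem_filter.1 hf).1⟩
  -- Two edges through the same `u` have different `v` by linearity, so `X` contains at least two
  -- leaves.
  have hnonconst : ∃ i, ∃ a ∈ X ∩ R, ∃ b ∈ X ∩ R, P a i ≠ P b i := by
    have h1 := hdeg _ (hFXF f₀ hf₀).2.2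
    obtain ⟨f, hf, g, hg, hfg⟩ := one_lt_card.1 (by omega : 1 < #{f ∈ FX | u f₀ = v f ∨ u f₀ = u f})
    have key : ∀ f ∈ {f ∈ FX | u f₀ = v f ∨ u f₀ = u f}, f ∈ FX ∧ u f₀ = u f := by
      intro f hf
      obtain ⟨hf1, hf2⟩ := mem_filter.1 hf
      refine ⟨hf1, hf2.resolve_left fun h => ?_⟩
      exact huR f₀ (hFXF f₀ hf₀).1 (h ▸ (hv f (hFXF f hf1).1).2)
    obtain ⟨hf1, hf2⟩ := key f hf
    obtain ⟨hg1, hg2⟩ := key g hg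
    have hfF := (hFXF f hf1).1
    have hgF := (hFXF g hg1).1
    refine ⟨t, v f, mem_inter.2 ⟨(hFXF f hf1).2.1, (hv f hfF).2⟩, v g,
      mem_inter.2 ⟨(hFXF g hg1).2.1, (hv g hgF).2⟩, ?_⟩
    rw [hB.leaf _ (hR (hv f hfF).2), hB.leaf _ (hR (hv g hgF).2)]
    intro hvv
    refine (hu f hfF).2 (card_le_one.1 (hlin f (hFE hfF) g (hFE hgF) hfg) _ ?_ _ ?_)
    · exact mem_inter.2 ⟨(hu f hfF).1, by rw [← hf2, hg2]; exact (hu g hgF).1⟩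
    · exact mem_inter.2 ⟨(hv f hfF).1, hvv ▸ (hv g hgF).1⟩
  -- Level `j` is the last one at which all leaves in `X` share their ancestor; the ancestors at
  -- level `j + 1` serve as labels.
  obtain ⟨j, hjt, hconst, a₀, ha₀, b₀, hb₀, hab₀⟩ : ∃ j < t,
      (∀ a ∈ X ∩ R, ∀ b ∈ X ∩ R, P a j = P b j) ∧
      ∃ a ∈ X ∩ R, ∃ b ∈ X ∩ R, P a (j + 1) ≠ P b (j + 1) := by
    by_contra hno
    push Not at hno
    have hall : ∀ j ≤ t, ∀ a ∈ X ∩ R, ∀ b ∈ X ∩ R, P a j = P b j := by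
      intro j
      induction j with
      | zero =>
        intro _ a ha b hb
        rw [hB.root a (hR (mem_inter.1 ha).2), hB.root b (hR (mem_inter.1 hb).2)]
      | succ j ih =>
        intro hj
        exact hno j (by omega) (ih (by omega))
    have hsub : ∀ a ∈ X ∩ R, ∀ b ∈ X ∩ R, a = b := by
      intro a ha b hb
      have := hall t le_rfl a ha b hb
      rwa [hB.leaf a (hR (mem_inter.1 ha).2), hB.leaf b (hR (mem_inter.1 hb).2)] at this
    obtain ⟨i, a, ha, b, hb, hab⟩ := hnonconst
    exact hab (by rw [hsub a ha b hb])
  -- If the edges at each `u` agreed on the label, the vertices labelled like `a₀` would be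
  -- separated from the rest of `X`, against connectedness.
  obtain ⟨f, hf, g, hg, hufg, hlab⟩ : ∃ f ∈ FX, ∃ g ∈ FX, u f = u g ∧
      P (v f) (j + 1) ≠ P (v g) (j + 1) := by
    by_contra hno
    push Not at hno
    set Y := X.filter (fun y => (y ∈ R → P y (j + 1) = P a₀ (j + 1)) ∧
      ∀ f ∈ FX, u f = y → P (v f) (j + 1) = P a₀ (j + 1)) with hY
    have hRu : ∀ y ∈ R, ∀ f ∈ FX, u f ≠ y := fun y hy f hf h =>
      huR f (hFXF f hf).1 (h ▸ hy)
    obtain ⟨f, hf, hfX, hf1, hf2⟩ := hX.exists_crossing (Y := Y) (filter_subset _ _)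
      ⟨a₀, mem_filter.2 ⟨(mem_inter.1 ha₀).1, fun _ => rfl,
        fun f hf h => absurd h (hRu a₀ (mem_inter.1 ha₀).2 f hf)⟩⟩
      ⟨b₀, mem_sdiff.2 ⟨(mem_inter.1 hb₀).1, fun h =>
        hab₀ ((mem_filter.1 h).2.1 (mem_inter.1 hb₀).2).symm⟩⟩
    have hfFX := hFX_of f hf hfX
    have hvX := (hFXF f hfFX).2.1
    have huX := (hFXF f hfFX).2.2
    have hvR := (hv f hf).2
    have hiff : v f ∈ Y ↔ u f ∈ Y := by
      simp only [hY, mem_filter, hvX, huX, true_and, huR f hf, hvR, true_imp_iff, false_imp_iff]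
      constructor
      · rintro ⟨h1, _⟩ g hg hgu
        rw [← h1]
        exact hno g hg f hfFX hgu
      · intro h
        exact ⟨h f hfFX rfl, fun g hg h => absurd h (hRu _ hvR g hg)⟩
    by_cases h : v f ∈ Y
    · apply hf1
      simp [insert_subset_iff, h, hiff.1 h]
    · apply hf2
      have h' : u f ∉ Y := fun h' => h (hiff.2 h')
      simp [insert_subset_iff, h, h', hvX, huX]
  refine ⟨j, hjt, fun i hi => ?_⟩
  have hfF := (hFXF f hf).1
  have hgF := (hFXF g hg).1
  have hFXE : FX ⊆ E := fun f hf => hFE (hFXF f hf).1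
  have hQ : #(f ∪ g) ≤ 2 * r := by
    have := card_union_le f g
    rw [hunif f (hFXE hf), hunif g (hFXE hg)] at this
    omega
  -- Avoiding `f ∪ g` costs `2 * r` and the path at most `r * (2 * i)` before its last edge: in all
  -- at most `2 * k * r`, below the minimum degree. Odd length makes the path end in `R`.
  obtain ⟨y, hyX, S₃, hS₃, hS₃Q, -, hyR⟩ := exists_linearPath_avoiding (F := FX) (v := v) (u := u)
    (R := R) (X := X) (Q := f ∪ g) (r := r) (m := 2 * i) (x := u f) (n := 2 * i + 1)
    (fun f hf => hunif f (hFXE hf)) (fun f hf g hg => hlin f (hFXE hf) g (hFXE hg))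
    (fun f hf => ⟨(hv f (hFXF f hf).1).1, (hv f (hFXF f hf).1).2, (hFXF f hf).2.1⟩)
    (fun f hf => ⟨(hu f (hFXF f hf).1).1, huR f (hFXF f hf).1, (hFXF f hf).2.2⟩)
    (fun y hy => lt_of_le_of_lt (by
      have : r * (2 * i) + 2 * r ≤ 2 * k * r := by
        have : r * (2 * i) + 2 * r = 2 * (i + 1) * r := by ring
        rw [this]
        gcongr
        omega
      omega) (hdeg y hy)) (hFXF f hf).2.2 (huR f hfF) le_rfl
  have hyR : y ∈ R := hyR.2 ⟨i, rfl⟩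
  -- The labels of `f` and `g` differ, so one of them differs from that of `y`. The path avoided
  -- both edges, as `y` was not known in advance.
  obtain ⟨h, hh, hhfg, huh, hne⟩ : ∃ h ∈ FX, h ⊆ f ∪ g ∧ u h = u f ∧
      P (v h) (j + 1) ≠ P y (j + 1) := by
    by_cases hc : P (v f) (j + 1) = P y (j + 1)
    · exact ⟨g, hg, subset_union_right, hufg.symm, fun h => hlab (hc.trans h.symm)⟩
    · exact ⟨f, hf, subset_union_left, rfl, hc⟩
  have hhF := (hFXF h hh).1
  obtain ⟨hah, haR⟩ := hv h hhF
  set a := v h with ha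
  have hS₃Q : ∀ z ∈ S₃, z ∉ h := fun z hz hz' => disjoint_left.1 hS₃Q hz (hhfg hz')
  have haL := hR haR
  have hyL := hR hyR
  have hz : P y j = P a j := hconst _ (mem_inter.2 ⟨hyX, hyR⟩) _
    (mem_inter.2 ⟨(hFXF h hh).2.1, haR⟩)
  -- Branches that separate never merge again.
  have hlabels : ∀ i, j ≤ i → i < t → P a (i + 1) ≠ P y (i + 1) := by
    intro i hji
    induction i, hji using Nat.le_induction with
    | base => exact fun _ => hne
    | succ i hji ih => exact fun hit heq => ih (by omega) (hB.parent a haL y hyL _ hit heq)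
  have hjj : t - (t - j) = j := by omega
  have hbranch : ∀ b ∈ L, ∃ S, LinearPath E (t - j) b (P b j) S ∧
      ∀ y ∈ S, ∃ i, j ≤ i ∧ i < t ∧ y ∈ (e b i).erase (P b i) := by
    intro b hb
    have := exists_linearPath_descending (hB.edge_mem b hb) (hB.left_mem b hb) (hB.right_mem b hb)
      (fun i hi j hj y h1 h2 => (hB.blocks b hb b hb i hi j hj y h1 h2).1)
      (d := t - j) (by omega)
    rwa [hjj, hB.leaf b hb] at this
  have hzblock : ∀ b ∈ L, ∀ i, j ≤ i → i < t → P a j ∉ (e b i).erase (P b i) := by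
    intro b hb i hji hit hmem
    rcases Nat.eq_zero_or_pos j with hj0 | hj0
    · rw [hj0, hB.root a haL] at hmem
      exact hB.root_notMem b hb i hit hmem
    · have h1 := hB.right_mem a haL (j - 1) (by omega)
      rw [Nat.sub_add_cancel hj0] at h1
      have := (hB.blocks a haL b hb (j - 1) (by omega) i hit _ h1 hmem).1
      omega
  obtain ⟨S₁, hS₁, hS₁'⟩ := hbranch a haL
  obtain ⟨S₂, hS₂, hS₂'⟩ := hbranch y hyL
  have hrev := hS₂.reverse (fun hmem => by
    obtain ⟨i, h1, h2, h3⟩ := hS₂' _ hmem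
    exact hzblock y hyL i h1 h2 (hz ▸ h3))
  rw [hz] at hrev
  have hsub₁ : ∀ w ∈ S₁, w ∈ O ∪ blk a := by
    intro w hw
    obtain ⟨i, _, h2, h3⟩ := hS₁' w hw
    exact hB.edge_subset a haL i h2 (mem_of_mem_erase h3)
  have hsub₂ : ∀ w ∈ (insert (P a j) S₂).erase y, w ∈ O ∪ blk y := by
    intro w hw
    rcases mem_insert.1 (mem_of_mem_erase hw) with rfl | hw
    · rw [← hz]
      exact hB.edge_subset y hyL j hjt (hB.left_mem y hyL j hjt)
    · obtain ⟨i, _, h2, h3⟩ := hS₂' w hw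
      exact hB.edge_subset y hyL i h2 (mem_of_mem_erase h3)
  have hya : y ≠ a := fun h => hne (by rw [h])
  have hS₃F : ∀ w ∈ S₃, ∃ f' ∈ F, w ∈ f' := by
    intro w hw
    obtain ⟨f', hf', hw'⟩ := hS₃.exists_edge_of_mem hw
    exact ⟨f', (hFXF f' hf').1, hw'⟩
  have hlast : LinearPath E 1 (u f) a (h.erase a) :=
    LinearPath.single (mem_erase.2 ⟨huh ▸ (hu h hhF).2, huh ▸ (hu h hhF).1⟩) (notMem_erase _ _)
      (by rw [insert_erase hah]; exact hFE hhF)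
  have hfull := ((hS₁.append hrev ?_).append (hS₃.mono hFXE) ?_).append hlast ?_
  · have hlen : 2 * (t - j) + 2 * (i + 1) = t - j + (t - j) + (2 * i + 1) + 1 := by ring
    rw [hlen]
    exact ⟨a, _, hfull⟩
  · rw [disjoint_left]
    intro w hw hw'
    obtain ⟨i, h1, h2, h3⟩ := hS₁' w hw
    rcases mem_insert.1 (mem_of_mem_erase hw') with rfl | hw'
    · exact hzblock a haL i h1 h2 h3
    · obtain ⟨i', h1', h2', h3'⟩ := hS₂' w hw'
      exact hlabels i h1 h2 (hB.blocks a haL y hyL i h2 i' h2' w h3 h3').2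
  · rw [disjoint_left]
    intro w hw hw'
    obtain ⟨f', hf', hwf'⟩ := hS₃F w hw'
    rcases mem_union.1 hw with hw | hw
    · have hwa := hF f' hf' a haR w hwf' (hsub₁ w hw)
      exact hS₃Q w hw' (by rw [hwa.2, ← hwa.1]; exact hah)
    · have hwa := hF f' hf' y hyR w hwf' (hsub₂ w hw)
      exact (mem_erase.1 hw).1 (by rw [hwa.2, ← hwa.1])
  · rw [disjoint_left]
    intro w hw hw'
    have hwh := mem_of_mem_erase hw'
    rcases mem_union.1 hw with hw | hw
    · rcases mem_union.1 hw with hw | hw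
      · exact (mem_erase.1 hw').1 (hF h hhF a haR w hwh (hsub₁ w hw)).2
      · exact hya (hF h hhF y hyR w hwh (hsub₂ w hw)).1
    · exact hS₃Q w hw hwh

/-! ### Sampling and maximal matchings -/

theorem two_pow_le_card_inter_eq_singleton {L N : Finset α} {a : α} {r : ℕ} (hN : N ⊆ L)
    (ha : a ∈ N) (hr : #N ≤ r) : 2 ^ #L ≤ 2 ^ r * #{R ∈ L.powerset | R ∩ N = {a}} := by
  have h1 : 2 ^ (#L - #N) ≤ #{R ∈ L.powerset | R ∩ N = {a}} := by
    rw [← card_sdiff_of_subset hN, ← card_powerset]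
    refine card_le_card_of_injOn (fun S => insert a S) ?_ ?_
    · intro S hS
      have hS := mem_powerset.1 hS
      rw [mem_coe, mem_filter, mem_powerset]
      refine ⟨insert_subset (hN ha) (hS.trans sdiff_subset), ?_⟩
      ext y
      simp only [mem_inter, mem_insert, mem_singleton]
      constructor
      · rintro ⟨h | h, hy⟩
        · exact h
        · exact absurd hy (mem_sdiff.1 (hS h)).2
      · rintro rfl
        exact ⟨Or.inl rfl, ha⟩
    · intro S hS T hT h
      have hS := mem_powerset.1 hS
      have hT := mem_powerset.1 hT
      have haS : a ∉ S := fun h => (mem_sdiff.1 (hS h)).2 ha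
      have haT : a ∉ T := fun h => (mem_sdiff.1 (hT h)).2 ha
      rw [← erase_insert haS, ← erase_insert haT]
      exact congrArg (fun A => A.erase a) h
  calc 2 ^ #L = 2 ^ #N * 2 ^ (#L - #N) := by
        rw [← pow_add, Nat.add_sub_cancel' (card_le_card hN)]
    _ ≤ 2 ^ r * #{R ∈ L.powerset | R ∩ N = {a}} :=
        Nat.mul_le_mul (Nat.pow_le_pow_right (by norm_num) hr) h1

/-- Averaging over all `R ⊆ L`: each `b` is good for a proportion at least `1 / m` of them, so some
`R` achieves the mean. -/
theorem exists_subset_sampling {β : Type*} (L : Finset α) (A : Finset β)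
    (good : Finset α → β → Prop) (m : ℕ)
    (h : ∀ b ∈ A, 2 ^ #L ≤ m * #{R ∈ L.powerset | good R b}) :
    ∃ R ⊆ L, #A ≤ m * #{b ∈ A | good R b} := by
  by_contra hno
  push Not at hno
  have h1 : ∑ R ∈ L.powerset, m * #{b ∈ A | good R b} < ∑ R ∈ L.powerset, #A :=
    sum_lt_sum_of_nonempty ⟨∅, empty_mem_powerset L⟩ (fun R hR => hno R (mem_powerset.1 hR))
  have h2 : ∑ b ∈ A, 2 ^ #L ≤ ∑ b ∈ A, m * #{R ∈ L.powerset | good R b} := sum_le_sum h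
  rw [← mul_sum] at h1 h2
  have h3 : ∑ R ∈ L.powerset, #{b ∈ A | good R b} = ∑ b ∈ A, #{R ∈ L.powerset | good R b} :=
    sum_card_bipartiteAbove_eq_sum_card_bipartiteBelow good
  rw [h3] at h1
  simp only [sum_const, card_powerset, smul_eq_mul] at h1 h2
  rw [mul_comm (#A)] at h2
  omega

theorem exists_maximal_disjoint {ι : Type*} (F : Finset ι) (τ : ι → Finset α)
    (hne : ∀ f ∈ F, (τ f).Nonempty) :
    ∃ M ⊆ F, (∀ f ∈ M, ∀ g ∈ M, f ≠ g → Disjoint (τ f) (τ g)) ∧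
      ∀ f ∈ F, ¬ Disjoint (τ f) (M.biUnion τ) := by
  obtain ⟨good, hgood⟩ : ∃ good : Finset ι → Prop, ∀ M, good M ↔
    ∀ f ∈ M, ∀ g ∈ M, f ≠ g → Disjoint (τ f) (τ g) := ⟨_, fun _ => Iff.rfl⟩
  obtain ⟨M, hM, hmax⟩ := exists_max_image (F.powerset.filter good) card
    ⟨∅, by simp [hgood]⟩
  obtain ⟨hMF, hM⟩ := mem_filter.1 hM
  rw [mem_powerset] at hMF
  rw [hgood] at hM
  refine ⟨M, hMF, hM, fun f hf hdis => ?_⟩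
  rw [disjoint_biUnion_right] at hdis
  have hfM : f ∉ M := fun h => (hne f hf).ne_empty (disjoint_self_iff_empty _ |>.1 (hdis f h))
  have := hmax (insert f M) (by
    rw [mem_filter, mem_powerset, hgood]
    refine ⟨insert_subset hf hMF, fun g hg g' hg' hne => ?_⟩
    rcases mem_insert.1 hg with h | h <;> rcases mem_insert.1 hg' with h' | h'
    · exact absurd (h.trans h'.symm) hne
    · exact h ▸ hdis g' h'
    · exact h' ▸ (hdis g h).symm
    · exact hM g h g' h' hne)
  rw [card_insert_of_notMem hfM] at this
  omega

/-! ### Growing trees weighted by degree -/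

/-- A tree is extended by a matching of edges leaving its leaves. -/
theorem IsBranching.extend {E : Finset (Finset α)} {x : α} {t : ℕ}
    {L O : Finset α} {blk : α → Finset α} {P : α → ℕ → α} {e : α → ℕ → Finset α}
    (hB : IsBranching E x t L O blk P e)
    (hlin : ∀ f ∈ E, ∀ g ∈ E, f ≠ g → #(f ∩ g) ≤ 1)
    {R : Finset α} (hR : R ⊆ L) {M : Finset (Finset α)} (hME : M ⊆ E) {v : Finset α → α}
    (hv : ∀ f ∈ M, v f ∈ f ∧ v f ∈ R)
    (hM : ∀ f ∈ M, ∀ a ∈ R, ∀ y ∈ f, y ∈ O ∪ blk a → a = v f ∧ y = v f)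
    (hdis : ∀ f ∈ M, ∀ g ∈ M, f ≠ g → Disjoint (f.erase (v f)) (g.erase (v g)))
    {L' : Finset α} {ψ : α → Finset α} (hψ : ∀ a ∈ L', ψ a ∈ M ∧ a ∈ (ψ a).erase (v (ψ a)))
    (hinj : ∀ a ∈ L', ∀ b ∈ L', ψ a = ψ b → a = b) :
    IsBranching E x (t + 1) L' (O ∪ L.biUnion blk) (fun a => (ψ a).erase (v (ψ a)))
      (fun a i => if i ≤ t then P (v (ψ a)) i else a)
      (fun a i => if i < t then e (v (ψ a)) i else ψ a) := by
  have hvL : ∀ a ∈ L', v (ψ a) ∈ L := fun a ha => hR (hv _ (hψ a ha).1).2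
  have hleaf : ∀ a ∈ L', P (v (ψ a)) t = v (ψ a) := fun a ha => hB.leaf _ (hvL a ha)
  have hold : ∀ a ∈ L', ∀ b ∈ L', ∀ i < t, ∀ y ∈ (e (v (ψ a)) i).erase (P (v (ψ a)) i),
      y ∉ (ψ b).erase (v (ψ b)) := by
    intro a ha b hb i hi y hy hy'
    have h1 := hB.edge_subset _ (hvL a ha) i hi (mem_of_mem_erase hy)
    exact (mem_erase.1 hy').1
      (hM _ (hψ b hb).1 _ (hv _ (hψ a ha).1).2 y (mem_of_mem_erase hy') h1).2
  have hblkO : ∀ a ∈ L', O ∪ blk (v (ψ a)) ⊆ O ∪ L.biUnion blk := fun a ha =>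
    union_subset_union_right (subset_biUnion_of_mem blk (hvL a ha))
  constructor
  · intro a ha
    simpa using hB.root _ (hvL a ha)
  · intro a ha
    simp
  · intro a ha i hi
    by_cases h : i < t
    · simpa only [if_pos h] using hB.edge_mem _ (hvL a ha) i h
    · simpa only [if_neg h] using hME (hψ a ha).1
  · intro a ha i hi
    by_cases h : i < t
    · simpa only [if_pos h, if_pos h.le] using hB.left_mem _ (hvL a ha) i h
    · obtain rfl : i = t := by omega
      simpa [hleaf a ha] using (hv _ (hψ a ha).1).1
  · intro a ha i hi
    by_cases h : i < t
    · simpa only [if_pos h, if_pos h.le, if_pos (Nat.succ_le_of_lt h)] using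
        hB.right_mem _ (hvL a ha) i h
    · obtain rfl : i = t := by omega
      simpa [hleaf a ha] using (hψ a ha).2
  · intro a ha b hb i hi j hj y hy hy'
    by_cases h : i < t <;> by_cases h' : j < t
    · simp only [if_pos h, if_pos h.le, if_pos h', if_pos h'.le, if_pos (Nat.succ_le_of_lt h)]
        at hy hy' ⊢
      exact hB.blocks _ (hvL a ha) _ (hvL b hb) i h j h' y hy hy'
    · obtain rfl : j = t := by omega
      simp only [if_pos h, if_pos h.le, lt_irrefl, if_false, le_refl, if_true, hleaf b hb] at hy hy'
      exact absurd hy' (hold a ha b hb i h y hy)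
    · obtain rfl : i = t := by omega
      simp only [if_pos h', if_pos h'.le, lt_irrefl, if_false, le_refl, if_true, hleaf a ha]
        at hy hy'
      exact absurd hy (hold b hb a ha j h' y hy')
    · obtain rfl : i = t := by omega
      obtain rfl : j = i := by omega
      simp only [lt_irrefl, if_false, le_refl, if_true, hleaf a ha, hleaf b hb] at hy hy'
      refine ⟨rfl, ?_⟩
      have hab : a = b := by
        by_contra hab
        exact disjoint_left.1 (hdis _ (hψ a ha).1 _ (hψ b hb).1
          (fun h => hab (hinj a ha b hb h))) hy hy'
      rw [hab]
  · intro a ha b hb i hi hab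
    by_cases h : i < t
    · simp only [if_pos h.le, if_pos (Nat.succ_le_of_lt h)] at hab ⊢
      exact hB.parent _ (hvL a ha) _ (hvL b hb) i h hab
    · obtain rfl : i = t := by omega
      simp only [Nat.not_succ_le_self, if_false] at hab
      rw [hab]
  · intro a ha i hi
    by_cases h : i < t
    · simpa only [if_pos h, if_pos h.le] using hB.root_notMem _ (hvL a ha) i h
    · obtain rfl : i = t := by omega
      simp only [lt_irrefl, if_false, le_refl, if_true, hleaf a ha]
      intro hx
      exact (mem_erase.1 hx).1 (hM _ (hψ a ha).1 _ (hv _ (hψ a ha).1).2 x (mem_of_mem_erase hx)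
        (hB.root_mem _ (hvL a ha))).2
  · exact fun a ha => (hψ a ha).2
  · intro a ha b hb hab
    exact hdis _ (hψ a ha).1 _ (hψ b hb).1 (fun h => hab (hinj a ha b hb h))
  · intro a ha
    exact mem_union_left _ (hblkO a ha (hB.root_mem _ (hvL a ha)))
  · intro a ha i hi
    by_cases h : i < t
    · simp only [if_pos h]
      exact ((hB.edge_subset _ (hvL a ha) i h).trans (hblkO a ha)).trans subset_union_left
    · simp only [if_neg h]
      intro y hy
      by_cases hyv : y = v (ψ a)
      · rw [hyv]
        exact mem_union_left _ (hblkO a ha (mem_union_right _ (hB.mem_blk _ (hvL a ha))))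
      · exact mem_union_right _ (mem_erase.2 ⟨hyv, hy⟩)
  · intro a ha f hf hfO
    have hne : f ≠ ψ a := by
      rintro rfl
      exact disjoint_left.1 hfO (hv _ (hψ a ha).1).1
        (hblkO a ha (mem_union_right _ (hB.mem_blk _ (hvL a ha))))
    exact (card_le_card (inter_subset_inter_left (erase_subset _ _))).trans
      (hlin f hf _ (hME (hψ a ha).1) hne)

/-- The number of edges of `E` containing `y`. -/
noncomputable def edgeDegree (E : Finset (Finset α)) (y : α) : ℕ := #{f ∈ E | y ∈ f}

/-- Among the edges at a set `L` of vertices, few meet a set `O` of small total degree. -/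
theorem sum_edgeDegree_le {E : Finset (Finset α)} {r : ℕ} (hunif : ∀ f ∈ E, #f = r)
    (L O : Finset α) :
    ∑ a ∈ L, edgeDegree E a ≤ ∑ a ∈ L, #{f ∈ E | a ∈ f ∧ Disjoint f O} +
      r * ∑ y ∈ O, edgeDegree E y := by
  have h1 : ∑ a ∈ L, edgeDegree E a = ∑ a ∈ L, #{f ∈ E | a ∈ f ∧ Disjoint f O} +
      ∑ a ∈ L, #{f ∈ {f ∈ E | ¬ Disjoint f O} | a ∈ f} := by
    rw [← sum_add_distrib]
    refine sum_congr rfl fun a _ => ?_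
    rw [edgeDegree, ← card_filter_add_card_filter_not (s := {f ∈ E | a ∈ f})
      (fun f => Disjoint f O), filter_filter, filter_filter, filter_filter]
    simp only [and_comm]
  rw [h1]
  gcongr
  -- An edge meeting `O` is counted at most `r` times on the left, and at least once among the
  -- degrees in `O`.
  calc ∑ a ∈ L, #{f ∈ {f ∈ E | ¬ Disjoint f O} | a ∈ f}
      = ∑ f ∈ {f ∈ E | ¬ Disjoint f O}, #{a ∈ L | a ∈ f} :=
        sum_card_bipartiteAbove_eq_sum_card_bipartiteBelow (fun a f => a ∈ f)
    _ ≤ ∑ f ∈ {f ∈ E | ¬ Disjoint f O}, r := by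
        refine sum_le_sum fun f hf => ?_
        rw [← hunif f (mem_filter.1 hf).1]
        exact card_le_card fun y hy => (mem_filter.1 hy).2
    _ = r * #{f ∈ E | ¬ Disjoint f O} := by rw [sum_const, smul_eq_mul, mul_comm]
    _ ≤ r * ∑ y ∈ O, edgeDegree E y := by
        gcongr
        refine (card_le_card ?_).trans (card_biUnion_le (s := O) (t := fun y => {f ∈ E | y ∈ f}))
        intro f hf
        obtain ⟨hf, hfO⟩ := mem_filter.1 hf
        obtain ⟨y, hy, hyO⟩ := not_disjoint_iff.1 hfO
        exact mem_biUnion.2 ⟨y, hyO, mem_filter.2 ⟨hf, hy⟩⟩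

/-- Many edges at the leaves of a tree meet the branches to a suitable subset `R` of the leaves
only in an element of `R`. -/
theorem IsBranching.exists_sampling {E : Finset (Finset α)} {x : α} {t : ℕ}
    {L O : Finset α} {blk : α → Finset α} {P : α → ℕ → α} {e : α → ℕ → Finset α}
    (hB : IsBranching E x t L O blk P e) {r : ℕ} (hunif : ∀ f ∈ E, #f = r)
    (hO : 2 * r * ∑ y ∈ O, edgeDegree E y ≤ ∑ a ∈ L, edgeDegree E a) :
    ∃ R ⊆ L, ∃ F ⊆ E, ∃ v : Finset α → α, (∀ f ∈ F, v f ∈ f ∧ v f ∈ R) ∧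
      (∀ f ∈ F, ∀ a ∈ R, ∀ y ∈ f, y ∈ O ∪ blk a → a = v f ∧ y = v f) ∧
      ∑ a ∈ L, edgeDegree E a ≤ 2 ^ (r + 1) * #F := by
  have : Nonempty α := ⟨x⟩
  set A : Finset (Σ _ : α, Finset α) := L.sigma fun a => {f ∈ E | a ∈ f ∧ Disjoint f O} with hA
  have hAmem : ∀ b ∈ A, b.1 ∈ L ∧ b.2 ∈ E ∧ b.1 ∈ b.2 ∧ Disjoint b.2 O := by
    intro b hb
    obtain ⟨h1, h2⟩ := mem_sigma.1 hb
    exact ⟨h1, mem_filter.1 h2⟩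
  have hcardA : ∑ a ∈ L, edgeDegree E a ≤ 2 * #A := by
    have h1 := sum_edgeDegree_le hunif L O
    have h2 : #A = ∑ a ∈ L, #{f ∈ E | a ∈ f ∧ Disjoint f O} := card_sigma _ _
    rw [← h2] at h1
    rw [mul_assoc] at hO
    omega
  set N : Finset α → Finset α := fun f => {b ∈ L | ¬ Disjoint f (blk b)} with hN
  have hNcard : ∀ f ∈ E, #(N f) ≤ r := by
    intro f hf
    rw [← hunif f hf]
    have hch : ∀ b ∈ N f, ∃ y ∈ f, y ∈ blk b := fun b hb => not_disjoint_iff.1 (mem_filter.1 hb).2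
    choose! y hy hyb using hch
    refine card_le_card_of_injOn y (fun b hb => hy b hb) ?_
    intro b hb b' hb' hbb
    by_contra hne
    exact disjoint_left.1 (hB.disjoint_blk b (mem_filter.1 hb).1 b' (mem_filter.1 hb').1 hne)
      (hyb b hb) (hbb ▸ hyb b' hb')
  obtain ⟨good, hgood⟩ : ∃ good : Finset α → (Σ _ : α, Finset α) → Prop,
    ∀ R b, good R b ↔ R ∩ N b.2 = {b.1} := ⟨_, fun _ _ => Iff.rfl⟩
  -- An edge meets at most `r` of the disjoint blocks, so a uniformly random `R` selects exactly the
  -- leaf `b.1` among them with probability at least `2 ^ (-r)`.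
  obtain ⟨R, hRL, hR⟩ := exists_subset_sampling L A good (2 ^ r) (by
    intro b hb
    obtain ⟨h1, h2, h3, h4⟩ := hAmem b hb
    have hb : b.1 ∈ N b.2 := mem_filter.2 ⟨h1, not_disjoint_iff.2 ⟨b.1, h3, hB.mem_blk _ h1⟩⟩
    rw [filter_congr (fun R _ => hgood R b)]
    exact two_pow_le_card_inter_eq_singleton (N := N b.2) (filter_subset _ _) hb (hNcard _ h2))
  set AR := A.filter (good R) with hAR
  -- The edge determines its selected leaf, so no edge is counted twice.
  have hARinj : Set.InjOn Sigma.snd (AR : Set (Σ _ : α, Finset α)) := by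
    rintro ⟨a, f⟩ h1 ⟨b, g⟩ h2 hfg
    obtain rfl : f = g := hfg
    have h1 := (hgood _ _).1 (mem_filter.1 h1).2
    have h2 := (hgood _ _).1 (mem_filter.1 h2).2
    obtain rfl : a = b := singleton_injective (h1.symm.trans h2)
    rfl
  have hch : ∀ f ∈ AR.image Sigma.snd, ∃ a, (⟨a, f⟩ : Σ _ : α, Finset α) ∈ AR := by
    intro f hf
    obtain ⟨⟨a, g⟩, h, rfl⟩ := mem_image.1 hf
    exact ⟨a, h⟩
  choose! v hv using hch
  have hvN : ∀ f ∈ AR.image Sigma.snd, R ∩ N f = {v f} := fun f hf =>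
    (hgood _ _).1 (mem_filter.1 (hv f hf)).2
  have hvA : ∀ f ∈ AR.image Sigma.snd, v f ∈ L ∧ f ∈ E ∧ v f ∈ f ∧ Disjoint f O := fun f hf =>
    hAmem _ (mem_filter.1 (hv f hf)).1
  refine ⟨R, hRL, AR.image Sigma.snd, fun f hf => (hvA f hf).2.1, v, fun f hf => ⟨(hvA f hf).2.2.1,
    (mem_inter.1 ((hvN f hf).symm ▸ mem_singleton_self (v f))).1⟩, ?_, ?_⟩
  · intro f hf a ha y hy hyO
    obtain ⟨h1, h2, h3, h4⟩ := hvA f hf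
    have hyblk := (mem_union.1 hyO).resolve_left (disjoint_left.1 h4 hy)
    have hav : a = v f := by
      rw [← mem_singleton, ← hvN f hf]
      exact mem_inter.2 ⟨ha, mem_filter.2 ⟨hRL ha, not_disjoint_iff.2 ⟨y, hy, hyblk⟩⟩⟩
    subst hav
    exact ⟨rfl, card_le_one.1 (hB.card_inter_blk _ h1 f h2 h4) _ (mem_inter.2 ⟨hy, hyblk⟩) _
      (mem_inter.2 ⟨h3, hB.mem_blk _ h1⟩)⟩
  · rw [card_image_of_injOn hARinj]
    calc _ ≤ 2 * #A := hcardA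
      _ ≤ 2 * (2 ^ r * #AR) := Nat.mul_le_mul_left 2 hR
      _ = 2 ^ (r + 1) * #AR := by ring

/-- `E` contains a tree of height `t` with root `x`, whose leaves have total degree at least `W`,
much more than the total degree of the other vertices. -/
def HasHeavyTree (E : Finset (Finset α)) (r : ℕ) (x : α) (t : ℕ) (W : ℝ) : Prop :=
  ∃ L O blk P e, IsBranching E x t L O blk P e ∧ (∀ a ∈ L, ∃ f ∈ E, a ∈ f) ∧
    2 * r * ∑ y ∈ O, edgeDegree E y ≤ ∑ a ∈ L, edgeDegree E a ∧
    (∀ a ∈ L, ∑ y ∈ blk a, edgeDegree E y ≤ r * edgeDegree E a) ∧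
    W ≤ ∑ a ∈ L, (edgeDegree E a : ℝ)

theorem HasHeavyTree.zero (E : Finset (Finset α)) {r : ℕ} (hr : 1 ≤ r) {x : α}
    (hx : ∃ f ∈ E, x ∈ f) : HasHeavyTree E r x 0 (edgeDegree E x) := by
  refine ⟨{x}, ∅, fun a => {a}, fun a _ => a, fun _ _ => ∅, ?_, by simpa using hx, by simp,
    by simpa using Nat.le_mul_of_pos_left _ hr, by simp⟩
  constructor <;> simp
  intro f _
  exact (card_le_card inter_subset_right).trans (card_singleton x).le

/-- The dichotomy on the auxiliary graph. In the sparse case a vertex of largest degree in each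
matching block becomes a leaf, so the new leaves carry at least a fraction `1 / r` of the weight of
`U`, itself at least `δ * #U`. -/
theorem HasHeavyTree.succ {E : Finset (Finset α)} {x : α} {t r k : ℕ} {W δ γ : ℝ}
    (h : HasHeavyTree E r x t W) (hW : 0 < W) (hr : 2 ≤ r) (hk : 1 ≤ k)
    (hunif : ∀ f ∈ E, #f = r) (hlin : ∀ f ∈ E, ∀ g ∈ E, f ≠ g → #(f ∩ g) ≤ 1)
    (hδ : ∀ f ∈ E, ∀ y ∈ f, δ ≤ edgeDegree E y) (hγδ : γ * (2 ^ (r + 3) * k * r ^ 2) ≤ δ)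
    (hγ : 3 * (r : ℝ) ^ 2 ≤ γ) :
    (∃ j < t, ∀ i < k, ∃ a S, LinearPath E (2 * (t - j) + 2 * (i + 1)) a a S) ∨
      HasHeavyTree E r x (t + 1) (γ * W) := by
  obtain ⟨L, O, blk, P, e, hB, hL, hO, hblk, hWL⟩ := h
  obtain ⟨R, hRL, F, hFE, v, hv, hF, hcard⟩ := hB.exists_sampling hunif hO
  obtain ⟨M, hMF, hMd, hMmax⟩ := exists_maximal_disjoint F (fun f => f.erase (v f)) (by
    intro f hf
    rw [← card_pos, card_erase_of_mem (hv f hf).1, hunif f (hFE hf)]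
    omega)
  have hwL : (∑ a ∈ L, (edgeDegree E a : ℝ)) ≤ 2 ^ (r + 1) * #F := by exact_mod_cast hcard
  have hF0 : F.Nonempty := by
    rw [nonempty_iff_ne_empty]
    rintro rfl
    simp at hwL
    linarith
  set U := M.biUnion (fun f => f.erase (v f)) with hU
  have : Nonempty α := ⟨x⟩
  have hch : ∀ f ∈ F, ∃ y ∈ f.erase (v f), y ∈ U := fun f hf => not_disjoint_iff.1 (hMmax f hf)
  choose! u hu huU using hch
  by_cases hdense : ((2 * k * r : ℕ) : ℝ) * (#R + #U) ≤ #F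
  · left
    obtain ⟨f₀, hf₀⟩ := hF0
    obtain ⟨X, -, hX⟩ := exists_isMinimalDense F (fun f => {v f, u f}) (2 * k * r : ℕ) (R ∪ U)
      ⟨v f₀, mem_union_left _ (hv f₀ hf₀).2⟩ (by
        rw [filter_true_of_mem (fun f hf => by
          simp [insert_subset_iff, (hv f hf).2, huU f hf])]
        refine le_trans ?_ hdense
        gcongr
        exact_mod_cast card_union_le R U)
    exact hB.exists_closed_linearPath hr hk hunif hlin hRL hFE hv hF
      (fun f hf => ⟨mem_of_mem_erase (hu f hf), (mem_erase.1 (hu f hf)).1⟩) hX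
  · right
    push Not at hdense
    have hch : ∀ f ∈ M, ∃ y ∈ f.erase (v f), ∀ z ∈ f.erase (v f),
        edgeDegree E z ≤ edgeDegree E y := by
      intro f hf
      exact exists_max_image _ _ ⟨u f, hu f (hMF hf)⟩
    choose! c hc hcmax using hch
    have hcinj : ∀ f ∈ M, ∀ g ∈ M, c f = c g → f = g := by
      intro f hf g hg hfg
      by_contra hne
      exact disjoint_left.1 (hMd f hf g hg hne) (hc f hf) (hfg ▸ hc g hg)
    have hch : ∀ a ∈ M.image c, ∃ f ∈ M, c f = a := fun a ha => mem_image.1 ha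
    choose! ψ hψM hψc using hch
    have hB' := hB.extend hlin hRL (hMF.trans hFE) (fun f hf => hv f (hMF hf))
      (fun f hf => hF f (hMF hf)) hMd (L' := M.image c) (ψ := ψ)
      (fun a ha => ⟨hψM a ha, by simpa only [hψc a ha] using hc _ (hψM a ha)⟩)
      (fun a ha b hb hab => by rw [← hψc a ha, ← hψc b hb, hab])
    have hblkc : ∀ f ∈ M, ∑ y ∈ f.erase (v f), edgeDegree E y ≤ r * edgeDegree E (c f) := by
      intro f hf
      calc ∑ y ∈ f.erase (v f), edgeDegree E y
          ≤ #(f.erase (v f)) • edgeDegree E (c f) := sum_le_card_nsmul _ _ _ (hcmax f hf)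
        _ ≤ r * edgeDegree E (c f) := by
          rw [smul_eq_mul]
          gcongr
          exact card_erase_le.trans (hunif f (hFE (hMF hf))).le
    have hw' : ∑ a ∈ M.image c, (edgeDegree E a : ℝ) = ∑ f ∈ M, (edgeDegree E (c f) : ℝ) :=
      sum_image hcinj
    have hr0 : (0 : ℝ) < r := by exact_mod_cast (by omega : 0 < r)
    have hr1 : (1 : ℝ) ≤ r := by exact_mod_cast (by omega : 1 ≤ r)
    have hk1 : (1 : ℝ) ≤ k := by exact_mod_cast hk
    have hp : (0 : ℝ) < 2 ^ r := by positivity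
    have hwU : δ * #U ≤ r * ∑ a ∈ M.image c, (edgeDegree E a : ℝ) := by
      calc δ * #U ≤ ∑ y ∈ U, (edgeDegree E y : ℝ) := by
            rw [mul_comm, ← nsmul_eq_mul]
            refine card_nsmul_le_sum _ _ _ fun y hy => ?_
            obtain ⟨f, hf, hyf⟩ := mem_biUnion.1 hy
            exact hδ f (hFE (hMF hf)) y (mem_of_mem_erase hyf)
        _ = ∑ f ∈ M, ∑ y ∈ f.erase (v f), (edgeDegree E y : ℝ) :=
            sum_biUnion (fun f hf g hg h => hMd f hf g hg h)
        _ ≤ ∑ f ∈ M, (r : ℝ) * edgeDegree E (c f) :=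
            sum_le_sum fun f hf => by exact_mod_cast hblkc f hf
        _ = r * ∑ a ∈ M.image c, (edgeDegree E a : ℝ) := by rw [hw', mul_sum]
    have hwR : δ * #R ≤ 2 ^ (r + 1) * #F := by
      refine le_trans ?_ hwL
      calc δ * #R ≤ ∑ y ∈ R, (edgeDegree E y : ℝ) := by
            rw [mul_comm, ← nsmul_eq_mul]
            refine card_nsmul_le_sum _ _ _ fun y hy => ?_
            obtain ⟨f, hf, hyf⟩ := hL y (hRL hy)
            exact hδ f hf y hyf
        _ ≤ ∑ y ∈ L, (edgeDegree E y : ℝ) :=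
            sum_le_sum_of_subset_of_nonneg hRL fun _ _ _ => Nat.cast_nonneg _
    have hγ1 : 1 ≤ γ * r := by nlinarith [one_le_pow₀ hr1 (n := 2)]
    have hγ0 : 0 < γ := by nlinarith
    -- Since `δ * #R` is at most the old weight, `R` accounts for at most half of `#F` in the failed
    -- density inequality; the other half must come from `U`.
    have hR2 : 2 * ((2 * k * r : ℕ) : ℝ) * #R ≤ #F := by
      have h1 : 2 ^ (r + 1) * (2 * ((2 * k * r : ℕ) : ℝ)) ≤ δ := by
        refine le_trans ?_ hγδ
        push_cast
        have : (2 : ℝ) ^ (r + 1) * (2 * (2 * k * r)) * 1 ≤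
            (2 : ℝ) ^ (r + 1) * (2 * (2 * k * r)) * (γ * r) := by gcongr
        calc _ = (2 : ℝ) ^ (r + 1) * (2 * (2 * k * r)) * 1 := by ring
          _ ≤ _ := this
          _ = _ := by ring
      have h2 : 2 ^ (r + 1) * (2 * ((2 * k * r : ℕ) : ℝ) * #R) ≤ 2 ^ (r + 1) * #F := by
        refine le_trans ?_ hwR
        calc _ = 2 ^ (r + 1) * (2 * ((2 * k * r : ℕ) : ℝ)) * #R := by ring
          _ ≤ _ := by gcongr
      exact le_of_mul_le_mul_left h2 (by positivity)
    have hFU : (#F : ℝ) ≤ 2 * ((2 * k * r : ℕ) : ℝ) * #U := by nlinarith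
    have hgrow : γ * ∑ a ∈ L, (edgeDegree E a : ℝ) ≤ ∑ a ∈ M.image c, (edgeDegree E a : ℝ) := by
      refine le_of_mul_le_mul_left (le_trans ?_ hwU) hr0
      calc (r : ℝ) * (γ * ∑ a ∈ L, (edgeDegree E a : ℝ))
          ≤ r * (γ * (2 ^ (r + 1) * (2 * ((2 * k * r : ℕ) : ℝ) * #U))) := by
            gcongr
            refine hwL.trans ?_
            gcongr
        _ = γ * (2 ^ (r + 3) * k * r ^ 2) * #U := by push_cast; ring
        _ ≤ δ * #U := by gcongr
    refine ⟨M.image c, _, _, _, _, hB', ?_, ?_, ?_, ?_⟩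
    · intro a ha
      obtain ⟨f, hf, rfl⟩ := mem_image.1 ha
      exact ⟨f, hFE (hMF hf), mem_of_mem_erase (hc f hf)⟩
    · have h1 : ∑ y ∈ O ∪ L.biUnion blk, edgeDegree E y ≤
          ∑ y ∈ O, edgeDegree E y + ∑ a ∈ L, r * edgeDegree E a := by
        calc ∑ y ∈ O ∪ L.biUnion blk, edgeDegree E y
            ≤ ∑ y ∈ O, edgeDegree E y + ∑ y ∈ L.biUnion blk, edgeDegree E y := by
              rw [← sum_union_inter]
              exact Nat.le_add_right _ _
          _ = ∑ y ∈ O, edgeDegree E y + ∑ a ∈ L, ∑ y ∈ blk a, edgeDegree E y := by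
              rw [sum_biUnion (fun a ha b hb h => hB.disjoint_blk a ha b hb h)]
          _ ≤ _ := by
              gcongr with a ha
              exact hblk a ha
      rw [← mul_sum] at h1
      -- The old inner vertices contribute at most one old leaf weight and the old blocks at most `2
      -- * r ^ 2`; this is why `γ ≥ 3 * r ^ 2` is required.
      have h2 : 2 * r * ∑ y ∈ O ∪ L.biUnion blk, edgeDegree E y ≤
          3 * r ^ 2 * ∑ a ∈ L, edgeDegree E a := by
        have h3 : 1 * ∑ a ∈ L, edgeDegree E a ≤ r ^ 2 * ∑ a ∈ L, edgeDegree E a := by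
          gcongr
          exact Nat.one_le_pow _ _ (by omega)
        have h4 := Nat.mul_le_mul_left (2 * r) h1
        calc _ ≤ _ := h4
          _ = 2 * r * ∑ y ∈ O, edgeDegree E y + 2 * (r ^ 2 * ∑ a ∈ L, edgeDegree E a) := by ring
          _ ≤ r ^ 2 * ∑ a ∈ L, edgeDegree E a + 2 * (r ^ 2 * ∑ a ∈ L, edgeDegree E a) := by omega
          _ = _ := by ring
      have h5 : 3 * (r : ℝ) ^ 2 * ∑ a ∈ L, (edgeDegree E a : ℝ) ≤
          ∑ a ∈ M.image c, (edgeDegree E a : ℝ) := by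
        refine le_trans ?_ hgrow
        gcongr
      exact h2.trans (by exact_mod_cast h5)
    · intro a ha
      have := hblkc (ψ a) (hψM a ha)
      rwa [hψc a ha] at this
    · refine le_trans ?_ hgrow
      gcongr

/-- In a linear `r`-graph of large minimum degree, trees grow until they give cycles of `k`
consecutive even lengths. -/
theorem exists_closed_linearPaths_of_minDegree {E : Finset (Finset α)} {X : Finset α} {r k n : ℕ}
    {δ γ : ℝ} (hX : X.Nonempty) (hXn : #X ≤ n) (hEX : ∀ f ∈ E, f ⊆ X) (hr : 2 ≤ r) (hk : 1 ≤ k)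
    (hunif : ∀ f ∈ E, #f = r) (hlin : ∀ f ∈ E, ∀ g ∈ E, f ≠ g → #(f ∩ g) ≤ 1)
    (hδ : ∀ y ∈ X, δ ≤ edgeDegree E y) (hγδ : γ * (2 ^ (r + 3) * k * r ^ 2) ≤ δ)
    (hγ : 3 * (r : ℝ) ^ 2 ≤ γ) :
    ∃ t : ℕ, γ ^ t ≤ n ∧ ∃ j < t, ∀ i < k, ∃ a S,
      LinearPath E (2 * (t - j) + 2 * (i + 1)) a a S := by
  -- A root of maximum degree makes the degree cancel when the leaf weight is compared with `n *
  -- edgeDegree E x`.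
  obtain ⟨x, hx, hxmax⟩ := exists_max_image X (edgeDegree E) hX
  have hr2 : (2 : ℝ) ≤ r := by exact_mod_cast hr
  have hγ1 : 1 < γ := by nlinarith
  have hδ0 : 0 < δ := by
    refine lt_of_lt_of_le ?_ hγδ
    have : (1 : ℝ) ≤ k := by exact_mod_cast hk
    positivity
  have hdx : (0 : ℝ) < edgeDegree E x := lt_of_lt_of_le hδ0 (hδ x hx)
  have hxE : ∃ f ∈ E, x ∈ f := by
    have : 0 < edgeDegree E x := by exact_mod_cast hdx
    obtain ⟨f, hf⟩ := card_pos.1 this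
    exact ⟨f, (mem_filter.1 hf).1, (mem_filter.1 hf).2⟩
  have hbound : ∀ t, HasHeavyTree E r x t (γ ^ t * edgeDegree E x) → γ ^ t ≤ n := by
    rintro t ⟨L, O, blk, P, e, -, hL, -, -, hW⟩
    refine le_of_mul_le_mul_right (hW.trans ?_) hdx
    have hLX : L ⊆ X := fun a ha => by
      obtain ⟨f, hf, haf⟩ := hL a ha
      exact hEX f hf haf
    calc ∑ a ∈ L, (edgeDegree E a : ℝ) ≤ #L • (edgeDegree E x : ℝ) :=
          sum_le_card_nsmul _ _ _ fun a ha => by exact_mod_cast hxmax a (hLX ha)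
      _ ≤ n * edgeDegree E x := by
          rw [nsmul_eq_mul]
          gcongr
          exact (card_le_card hLX).trans hXn
  by_contra hno
  push Not at hno
  have hall : ∀ t, HasHeavyTree E r x t (γ ^ t * edgeDegree E x) := by
    intro t
    induction t with
    | zero => simpa using HasHeavyTree.zero E (by omega) hxE
    | succ t ih =>
      rcases ih.succ (by positivity) hr hk hunif hlin (fun f hf y hy => hδ y (hEX f hf hy)) hγδ hγ
        with ⟨j, hj, h⟩ | h
      · obtain ⟨i, hi, h'⟩ := hno t (hbound t ih) j hj
        obtain ⟨a, S, hp⟩ := h i hi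
        exact absurd hp (h' a S)
      · convert h using 1
        ring
  obtain ⟨t, ht⟩ := pow_unbounded_of_one_lt (n : ℝ) hγ1
  exact absurd (hbound t (hall t)) (not_le.2 ht)

/-! ### From hypergraphs to finite edge sets, and the final estimates -/

/-- The edges of a hypergraph on a finite vertex set, as a finite set of finite sets. -/
noncomputable def edgeFinset (G : Hypergraph α) (h : V(G).Finite) : Finset (Finset α) :=
  {f ∈ h.toFinset.powerset | (f : Set α) ∈ E(G)}

theorem mem_edgeFinset {G : Hypergraph α} {h : V(G).Finite} {f : Finset α} :
    f ∈ edgeFinset G h ↔ (f : Set α) ∈ E(G) := by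
  rw [edgeFinset, mem_filter, mem_powerset, and_iff_right_iff_imp]
  intro hf y hy
  rw [Set.Finite.mem_toFinset]
  exact G.subset_vertexSet_of_mem_edgeSet hf hy

theorem degree_eq_edgeDegree (G : Hypergraph α) (h : V(G).Finite) (v : α) :
    degree G v = edgeDegree (edgeFinset G h) v := by
  rw [degree, edgeDegree, ← Set.ncard_coe_finset,
    ← Set.ncard_image_of_injective _ (coe_injective (α := α))]
  congr 1
  ext e
  constructor
  · rintro ⟨he, hv⟩
    have hfin : e.Finite := h.subset (G.subset_vertexSet_of_mem_edgeSet he)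
    refine ⟨hfin.toFinset, ?_, hfin.coe_toFinset⟩
    rw [mem_coe, mem_filter, mem_edgeFinset, hfin.coe_toFinset, Set.Finite.mem_toFinset]
    exact ⟨he, hv⟩
  · rintro ⟨f, hf, rfl⟩
    rw [mem_coe, mem_filter, mem_edgeFinset] at hf
    exact hf

theorem avgDegree_mul_card {G : Hypergraph α} (h : V(G).Finite) {r : ℕ} (hG : IsUniform G r)
    (hV : 0 < V(G).ncard) : avgDegree G * V(G).ncard = r * #(edgeFinset G h) := by
  rw [avgDegree, div_mul_cancel₀ _ (by positivity),
    finsum_mem_eq_finite_toFinset_sum _ h]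
  have h1 : ∑ v ∈ h.toFinset, degree G v = r * #(edgeFinset G h) := by
    simp only [degree_eq_edgeDegree G h, edgeDegree]
    rw [show ∑ v ∈ h.toFinset, #{f ∈ edgeFinset G h | v ∈ f} =
        ∑ f ∈ edgeFinset G h, #{v ∈ h.toFinset | v ∈ f} from
      sum_card_bipartiteAbove_eq_sum_card_bipartiteBelow (fun v f => v ∈ f),
      sum_congr rfl (g := fun _ => r), sum_const, smul_eq_mul, mul_comm]
    intro f hf
    have hf' := mem_edgeFinset.1 hf
    have hsub : {v ∈ h.toFinset | v ∈ f} = f := by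
      ext v
      simp only [mem_filter, Set.Finite.mem_toFinset, and_iff_right_iff_imp]
      exact fun hv => G.subset_vertexSet_of_mem_edgeSet hf' hv
    have := hG _ hf'
    rw [Set.encard_coe_eq_coe_finsetCard] at this
    rw [hsub]
    exact_mod_cast this
  exact_mod_cast h1

end LinearCycles

theorem theorem1p3 {α : Type*} (r k n : ℕ) (hr : 3 ≤ r) (hk : 2 ≤ k) (c₁ c₂ : ℝ)
    (hc₁ : c₁ = 128 * (r : ℝ) ^ (2 * r + 3))
    (hc₂ : c₂ = Real.logb 2 (64 * (r : ℝ) ^ (2 * r + 2)))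
    (G : Hypergraph α) (hfin : V(G).Finite) (hn : V(G).ncard = n)
    (hunif : LinearCycles.IsUniform G r) (hlin : LinearCycles.IsLinear G)
    (hd : c₁ * (k : ℝ) ≤ LinearCycles.avgDegree G) :
    ∃ m : ℕ,
      (∀ i < k, LinearCycles.ContainsLinearCycle G r (2 * (m + i))) ∧
      (2 * m : ℤ) ≤
        2 * ⌈Real.logb 2 n / (Real.logb 2 (LinearCycles.avgDegree G / k) - c₂)⌉ := by
  classical
  open LinearCycles Finset in
  set d := avgDegree G with hd_def
  have hr3 : (3 : ℝ) ≤ r := by exact_mod_cast hr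
  have hr0 : (0 : ℝ) < r := by linarith
  have hk0 : (0 : ℝ) < k := by exact_mod_cast (by omega : 0 < k)
  have hd0 : 0 < d := lt_of_lt_of_le (by rw [hc₁]; positivity) hd
  have hn0 : 0 < n := by
    rw [Nat.pos_iff_ne_zero]
    rintro rfl
    rw [hd_def, avgDegree, hn] at hd0
    simp at hd0
  have hcardE := avgDegree_mul_card hfin hunif (hn ▸ hn0)
  rw [hn, ← hd_def] at hcardE
  have hVn : #hfin.toFinset = n := by rw [← hn, Set.ncard_eq_toFinset_card _ hfin]
  have hE₀ : ∀ f ∈ edgeFinset G hfin, #f = r := by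
    intro f hf
    have := hunif _ (mem_edgeFinset.1 hf)
    rw [Set.encard_coe_eq_coe_finsetCard] at this
    exact_mod_cast this
  have hlin₀ : ∀ f ∈ edgeFinset G hfin, ∀ g ∈ edgeFinset G hfin, f ≠ g → #(f ∩ g) ≤ 1 := by
    intro f hf g hg hfg
    have := hlin _ (mem_edgeFinset.1 hf) _ (mem_edgeFinset.1 hg) (fun h => hfg (coe_injective h))
    rw [← coe_inter, Set.encard_coe_eq_coe_finsetCard] at this
    exact_mod_cast this
  -- Counting incidences, the whole vertex set spans exactly `d / r` edges per vertex.
  obtain ⟨X, hXV, hX⟩ := exists_isMinimalDense (edgeFinset G hfin) id (d / r) hfin.toFinset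
    (by rw [← card_pos, hVn]; exact hn0) (by
      rw [filter_true_of_mem (fun f hf => by
        intro y hy
        rw [Set.Finite.mem_toFinset]
        exact G.subset_vertexSet_of_mem_edgeSet (mem_edgeFinset.1 hf) hy), hVn, div_mul_eq_mul_div,
        hcardE, mul_div_cancel_left₀ _ hr0.ne'])
  set E := {f ∈ edgeFinset G hfin | f ⊆ X} with hE_def
  have hEsub : ∀ f ∈ E, f ∈ edgeFinset G hfin := fun f hf => (mem_filter.1 hf).1
  set γ := d / (2 ^ (r + 3) * k * r ^ 3) with hγ_def
  have hpow : (2 : ℝ) ^ r ≤ (r : ℝ) ^ r := by gcongr; linarith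
  have hpow3 : (r : ℝ) ^ 3 ≤ (r : ℝ) ^ r := pow_le_pow_right₀ (by linarith) hr
  have hDγ : d / k / (64 * (r : ℝ) ^ (2 * r + 2)) < γ := by
    rw [div_div, hγ_def]
    have hlt : (2 : ℝ) ^ (r + 3) * k * r ^ 3 < k * (64 * (r : ℝ) ^ (2 * r + 2)) := by
      have h1 : (r : ℝ) ^ (r + 3) ≤ (r : ℝ) ^ (2 * r + 2) :=
        pow_le_pow_right₀ (by linarith) (by omega)
      calc (2 : ℝ) ^ (r + 3) * (k : ℝ) * (r : ℝ) ^ 3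
          = 8 * (k : ℝ) * (2 ^ r * (r : ℝ) ^ 3) := by ring
        _ ≤ 8 * (k : ℝ) * ((r : ℝ) ^ r * (r : ℝ) ^ 3) := by gcongr
        _ = 8 * (k : ℝ) * (r : ℝ) ^ (r + 3) := by ring
        _ ≤ 8 * (k : ℝ) * (r : ℝ) ^ (2 * r + 2) := by gcongr 8 * (k : ℝ) * ?_
        _ < 64 * (k : ℝ) * (r : ℝ) ^ (2 * r + 2) := by gcongr; norm_num
        _ = _ := by ring
    gcongr
  have hD1 : 1 < d / k / (64 * (r : ℝ) ^ (2 * r + 2)) := by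
    rw [lt_div_iff₀ (by positivity), lt_div_iff₀ hk0]
    refine lt_of_lt_of_le ?_ hd
    rw [hc₁]
    have : (64 : ℝ) * (r : ℝ) ^ (2 * r + 2) < 128 * (r : ℝ) ^ (2 * r + 3) := by
      rw [pow_succ _ (2 * r + 2)]
      have : (0 : ℝ) < (r : ℝ) ^ (2 * r + 2) := by positivity
      nlinarith
    nlinarith
  have hγ3 : 3 * (r : ℝ) ^ 2 ≤ γ := by
    rw [hγ_def, le_div_iff₀ (by positivity)]
    refine le_trans ?_ hd
    rw [hc₁]
    calc 3 * (r : ℝ) ^ 2 * (2 ^ (r + 3) * (k : ℝ) * (r : ℝ) ^ 3)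
        = 8 * (3 * (r : ℝ) ^ 2) * 2 ^ r * (r : ℝ) ^ 3 * (k : ℝ) := by ring
      _ ≤ 8 * ((r : ℝ) * (r : ℝ) ^ 2) * (r : ℝ) ^ r * (r : ℝ) ^ 3 * (k : ℝ) := by gcongr
      _ = 8 * (r : ℝ) ^ 3 * (r : ℝ) ^ r * (r : ℝ) ^ 3 * (k : ℝ) := by ring
      _ ≤ 128 * (r : ℝ) ^ r * (r : ℝ) ^ r * (r : ℝ) ^ 3 * (k : ℝ) := by
        gcongr ?_ * ?_ * (r : ℝ) ^ r * (r : ℝ) ^ 3 * (k : ℝ)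
        norm_num
      _ = 128 * (r : ℝ) ^ (2 * r + 3) * (k : ℝ) := by ring
  obtain ⟨t, hγt, j, hjt, hpaths⟩ := exists_closed_linearPaths_of_minDegree (E := E) (X := X)
    (r := r) (k := k) (n := n) (δ := d / r) (γ := γ) hX.nonempty
    (hVn ▸ card_le_card hXV) (fun f hf => (mem_filter.1 hf).2) (by omega) (by omega)
    (fun f hf => hE₀ f (hEsub f hf)) (fun f hf g hg => hlin₀ f (hEsub f hf) g (hEsub g hg))
    (by
      intro y hy
      have h1 := hX.lt_degree (by positivity) (fun f hf => by
        rw [id, hE₀ f hf]; omega) hy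
      rw [edgeDegree, hE_def, filter_filter]
      exact h1.le)
    (le_of_eq (by rw [hγ_def]; field_simp)) hγ3
  -- The shortest cycle, at `i = 0`, has length `2 * (t - j) + 2`, which is at least 4 because `j <
  -- t`.
  refine ⟨t - j + 1, fun i hi => ?_, ?_⟩
  · obtain ⟨a, S, hp⟩ := hpaths i hi
    rw [show 2 * (t - j + 1 + i) = 2 * (t - j) + 2 * (i + 1) by ring]
    exact hp.containsLinearCycle (fun f hf => mem_edgeFinset.1 (hEsub f hf))
      (fun f hf => hE₀ f (hEsub f hf)) (by omega)
  · set D := d / k / (64 * (r : ℝ) ^ (2 * r + 2)) with hD_def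
    have hlogD : Real.logb 2 (d / k) - c₂ = Real.logb 2 D := by
      rw [hc₂, hD_def, ← Real.logb_div (by positivity) (by positivity)]
    rw [hlogD]
    -- Strictness, from `D < γ` and `t > 0`, gives `t + 1 ≤ ⌈·⌉` and so absorbs the extra 1 in `m`.
    have hDn : D ^ t < n :=
      lt_of_lt_of_le (pow_lt_pow_left₀ hDγ (by positivity) (by omega)) hγt
    have hlt : (t : ℝ) < Real.logb 2 n / Real.logb 2 D := by
      rw [lt_div_iff₀ (Real.logb_pos (by norm_num) hD1), ← Real.logb_pow]
      exact Real.logb_lt_logb (by norm_num) (by positivity) hDn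
    have hceil : (t : ℤ) < ⌈Real.logb 2 n / Real.logb 2 D⌉ := by
      rw [Int.lt_ceil]
      exact_mod_cast hlt
    push_cast [hjt.le]
    omega
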